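/- Let $(\Omega,\mathcal F,\mathbb P)$ be a probability space and let $X=(X_t)_{t\in\mathbb R_+}$ be a real valued almost-continuous process on it (not necessarily a martingale or a Markov process). That is, $X$ is cadlag (right-continuous with left limits, almost surely), continuous in probability, and for any two independent cadlag processes $Y,Z$, defined on a common probability space and each having the same distribution as $X$, and for all $s<t$ in $\mathbb R_+$, $$\mathbb P\bigl(Y_s<Z_s,\ Y_t>Z_t\text{ and }Y_u\neq Z_u\text{ for every }u\in(s,t)\bigr)=0 .$$ Let $\operatorname{supp}(X_t)$ denote the smallest closed set $F\subseteq\mathbb R$ with $\mathbb P(X_t\in F)=1$, and let $$\operatorname{MSupp}(X)=\{(t,x)\in\mathbb R_+\times\mathbb R: x\in\operatorname{supp}(X_t)\}$$ be the marginal support of $X$. Write $X_{t-}$ for the left limit of $X$ at $t>0$, and $X_{0-}=X_0$. Then, with probability one, the (random) set $$\{(t,x)\in\mathbb R_+\times\mathbb R: X_{t-}<x<X_t\text{ or }X_t<x<X_{t-}\}$$ is disjoint from $\operatorname{MSupp}(X)$. -/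

import Mathlib

open MeasureTheory ProbabilityTheory Filter Set Topology
open scoped NNReal

/-- A path `f : ℝ₊ → ℝ` is cadlag: right-continuous with (finite) left limits.
At `t = 0` the left-limit condition is vacuous, since `𝓝[<] 0 = ⊥`. -/
def CadlagPath (f : ℝ≥0 → ℝ) : Prop :=
  ∀ t : ℝ≥0, ContinuousWithinAt f (Ici t) t ∧ ∃ l : ℝ, Tendsto f (𝓝[<] t) (𝓝 l)

/-- A real valued cadlag process: each `X t` is a random variable and
almost every path is cadlag. -/
structure IsCadlagProcess {Ω : Type*} [MeasurableSpace Ω] (X : ℝ≥0 → Ω → ℝ)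
    (P : Measure Ω) : Prop where
  measurable : ∀ t, Measurable (X t)
  cadlag : ∀ᵐ ω ∂P, CadlagPath (fun t => X t ω)

/-- Continuity in probability: `X s → X t` in probability as `s → t`, for every `t`. -/
def IsContinuousInProbability {Ω : Type*} [MeasurableSpace Ω] (X : ℝ≥0 → Ω → ℝ)
    (P : Measure Ω) : Prop :=
  ∀ t : ℝ≥0, TendstoInMeasure P X (𝓝 t) (X t)

/-- Two processes, possibly on different probability spaces, have the same distribution:
their laws on the path space `ℝ₊ → ℝ`, with the product σ-algebra, agree. -/
def SameDistribution {Ω Ω' : Type*} [MeasurableSpace Ω] [MeasurableSpace Ω']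
    (Y : ℝ≥0 → Ω' → ℝ) (P' : Measure Ω') (X : ℝ≥0 → Ω → ℝ) (P : Measure Ω) : Prop :=
  IdentDistrib (fun ω t => Y t ω) (fun ω t => X t ω) P' P

universe u

/-- Almost-continuous processes: cadlag, continuous in probability, and for any two independent
cadlag processes `Y`, `Z` with the same distribution as `X` (on any probability space), the
probability that `Y` passes from strictly below `Z` at time `s` to strictly above `Z` at time `t`
without meeting `Z` in `(s, t)` is zero. The event is measurable for the completed measure;
`P' A = 0` is the vanishing of the outer measure, i.e. of the completed measure. -/
structure IsAlmostContinuous {Ω : Type u} [MeasurableSpace Ω] (X : ℝ≥0 → Ω → ℝ)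
    (P : Measure Ω) : Prop where
  cadlag : IsCadlagProcess X P
  continuousInProbability : IsContinuousInProbability X P
  noCrossing : ∀ (Ω' : Type u) [MeasurableSpace Ω'] (P' : Measure Ω') [IsProbabilityMeasure P']
    (Y Z : ℝ≥0 → Ω' → ℝ),
    IsCadlagProcess Y P' → IsCadlagProcess Z P' →
    SameDistribution Y P' X P → SameDistribution Z P' X P →
    IndepFun (fun ω t => Y t ω) (fun ω t => Z t ω) P' →
    ∀ s t : ℝ≥0, s < t →
      P' {ω | Y s ω < Z s ω ∧ Z t ω < Y t ω ∧ ∀ v ∈ Ioo s t, Y v ω ≠ Z v ω} = 0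

/-- The support of a real random variable: the topological support of its law. -/
def rvSupport {Ω : Type*} [MeasurableSpace Ω] (U : Ω → ℝ) (P : Measure Ω) : Set ℝ :=
  (P.map U).support

/-- `rvSupport U P` is the smallest closed set `F` with `P (U ∈ F) = 1`. -/
theorem isLeast_rvSupport {Ω : Type*} [MeasurableSpace Ω] (P : Measure Ω)
    [IsProbabilityMeasure P] (U : Ω → ℝ) (hU : Measurable U) :
    IsLeast {F : Set ℝ | IsClosed F ∧ P (U ⁻¹' F) = 1} (rvSupport U P) := by
  have : IsProbabilityMeasure (P.map U) := Measure.isProbabilityMeasure_map hU.aemeasurable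
  constructor
  · refine ⟨Measure.isClosed_support, ?_⟩
    rw [rvSupport, ← Measure.map_apply hU Measure.isClosed_support.measurableSet]
    exact (prob_compl_eq_zero_iff Measure.isClosed_support.measurableSet).1
      Measure.measure_compl_support
  · rintro F ⟨hF, h1⟩
    rw [← Measure.map_apply hU hF.measurableSet] at h1
    exact Measure.support_subset_of_isClosed hF
      (mem_ae_iff.2 ((prob_compl_eq_zero_iff hF.measurableSet).2 h1))

/-- The marginal support of a process `X`: all `(t, x)` with `x` in the support of `X t`. -/
def marginalSupport {Ω : Type*} [MeasurableSpace Ω] (X : ℝ≥0 → Ω → ℝ) (P : Measure Ω) :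
    Set (ℝ≥0 × ℝ) :=
  {p | p.2 ∈ rvSupport (X p.1) P}

/-- The points strictly between `f (t-)` and `f t`. For a cadlag path, `Function.leftLim f t` is
the left limit at `t > 0`, and it is `f 0` at `t = 0`. -/
def jumpGap (f : ℝ≥0 → ℝ) : Set (ℝ≥0 × ℝ) :=
  {p | (Function.leftLim f p.1 < p.2 ∧ p.2 < f p.1) ∨
    (f p.1 < p.2 ∧ p.2 < Function.leftLim f p.1)}

/-! Suppose the path of `ω` jumps across `x` at time `T`, with `x` in the support of `X T`. An
independent copy lies inside the open gap at time `T` with positive probability, and by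
`ae_leftLim_eq` it almost surely does not jump at `T`. The two paths then change order at `T`
without meeting nearby, so by `exists_crossing` they cross between two times of a countable dense
set. Fubini applied to `prod_noCrossing` makes this impossible for almost every copy, once `ω`
avoids a single null set. -/

/-- A cadlag path converges to its left limit at every positive time. -/
theorem CadlagPath.tendsto_leftLim {f : ℝ≥0 → ℝ} (hf : CadlagPath f) (t : ℝ≥0) :
    Tendsto f (𝓝[<] t) (𝓝 (Function.leftLim f t)) := by
  by_cases h : 𝓝[<] t = ⊥
  · simp [h]
  · obtain ⟨l, hl⟩ := (hf t).2
    have : (𝓝[<] t).NeBot := ⟨h⟩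
    rwa [leftLim_eq_of_tendsto hl]

/-- A cadlag process which is continuous in probability has no jump at a fixed time, almost
surely. -/
theorem IsContinuousInProbability.ae_leftLim_eq {Ω : Type*} [MeasurableSpace Ω] {P : Measure Ω}
    {X : ℝ≥0 → Ω → ℝ} (hX : IsContinuousInProbability X P) (hc : IsCadlagProcess X P)
    (t : ℝ≥0) : ∀ᵐ ω ∂P, Function.leftLim (fun v => X v ω) t = X t ω := by
  rcases eq_or_ne (𝓝[<] t) ⊥ with h | h
  · exact .of_forall fun ω => leftLim_eq_of_eq_bot _ h
  have : (𝓝[<] t).NeBot := ⟨h⟩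
  -- Along a sequence tending to `t` from the left, convergence in probability gives an almost
  -- surely convergent subsequence; its limit `X t` must be the left limit.
  obtain ⟨u, hu⟩ := exists_seq_tendsto (𝓝[<] t)
  have hm : TendstoInMeasure P (fun n => X (u n)) atTop (X t) := fun ε hε =>
    (hX t ε hε).comp (hu.mono_right nhdsWithin_le_nhds)
  obtain ⟨ns, hns, hlim⟩ := hm.exists_seq_tendsto_ae
  filter_upwards [hlim, hc.cadlag] with ω hω hcω
  exact tendsto_nhds_unique (((hcω.tendsto_leftLim t).comp hu).comp hns.tendsto_atTop) hω

/-- If `f` is strictly below `g` just before time `t` and strictly above it at `t`, in the sense of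
left limits and values, then `f` passes from below `g` to above `g` without meeting `g`, between two
times of any dense set. -/
theorem CadlagPath.exists_crossing {f g : ℝ≥0 → ℝ} (hf : CadlagPath f) (hg : CadlagPath g)
    {D : Set ℝ≥0} (hD : Dense D) {t : ℝ≥0}
    (h₁ : Function.leftLim f t < Function.leftLim g t) (h₂ : g t < f t) :
    ∃ s ∈ D, ∃ r ∈ D, s < r ∧ f s < g s ∧ g r < f r ∧ ∀ v ∈ Ioo s r, f v ≠ g v := by
  have ht : 0 < t := by
    refine pos_iff_ne_zero.2 fun h => ?_
    subst h
    have h0 : 𝓝[<] (0 : ℝ≥0) = ⊥ := by simp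
    rw [leftLim_eq_of_eq_bot f h0, leftLim_eq_of_eq_bot g h0] at h₁
    exact h₁.not_gt h₂
  have hleft : ∀ᶠ v in 𝓝[<] t, f v < g v :=
    (hf.tendsto_leftLim t).eventually_lt (hg.tendsto_leftLim t) h₁
  have hright : ∀ᶠ v in 𝓝[≥] t, g v < f v := (hg t).1.eventually_lt (hf t).1 h₂
  obtain ⟨a, hat, ha⟩ := (mem_nhdsLT_iff_exists_Ioo_subset' ht).1 hleft
  obtain ⟨b, htb, hb⟩ := (mem_nhdsGE_iff_exists_Ico_subset' (lt_add_one t)).1 hright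
  obtain ⟨s, hsD, has, hst⟩ := hD.exists_between hat
  obtain ⟨r, hrD, htr, hrb⟩ := hD.exists_between htb
  refine ⟨s, hsD, r, hrD, hst.trans htr, ha ⟨has, hst⟩, hb ⟨htr.le, hrb⟩, fun v hv => ?_⟩
  rcases lt_or_ge v t with h | h
  · exact (ha ⟨has.trans hv.1, h⟩ : f v < g v).ne
  · exact (hb ⟨h, hv.2.trans hrb⟩ : g v < f v).ne'

/-- Two independent copies of an almost-continuous process, realised on the product space, almost
surely never cross without meeting, in either direction. -/
theorem IsAlmostContinuous.prod_noCrossing {Ω : Type u} [MeasurableSpace Ω] {P : Measure Ω}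
    [IsProbabilityMeasure P] {X : ℝ≥0 → Ω → ℝ} (hX : IsAlmostContinuous X P) {s t : ℝ≥0}
    (hst : s < t) :
    (P.prod P) {p | X s p.1 < X s p.2 ∧ X t p.2 < X t p.1 ∧ ∀ v ∈ Ioo s t, X v p.1 ≠ X v p.2} = 0 ∧
    (P.prod P) {p | X s p.2 < X s p.1 ∧ X t p.1 < X t p.2 ∧
      ∀ v ∈ Ioo s t, X v p.2 ≠ X v p.1} = 0 := by
  have hpath : Measurable fun ω v => X v ω := measurable_pi_iff.2 hX.cadlag.measurable
  have hY : IsCadlagProcess (fun v (p : Ω × Ω) => X v p.1) (P.prod P) :=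
    ⟨fun v => (hX.cadlag.measurable v).comp measurable_fst,
      Measure.quasiMeasurePreserving_fst.ae hX.cadlag.cadlag⟩
  have hZ : IsCadlagProcess (fun v (p : Ω × Ω) => X v p.2) (P.prod P) :=
    ⟨fun v => (hX.cadlag.measurable v).comp measurable_snd,
      Measure.quasiMeasurePreserving_snd.ae hX.cadlag.cadlag⟩
  have hYd : SameDistribution (fun v (p : Ω × Ω) => X v p.1) (P.prod P) X P :=
    ⟨(hpath.comp measurable_fst).aemeasurable, hpath.aemeasurable, by
      rw [← (measurePreserving_fst (μ := P) (ν := P)).map_eq, Measure.map_map hpath measurable_fst,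
        measurePreserving_fst.map_eq]
      rfl⟩
  have hZd : SameDistribution (fun v (p : Ω × Ω) => X v p.2) (P.prod P) X P :=
    ⟨(hpath.comp measurable_snd).aemeasurable, hpath.aemeasurable, by
      rw [← (measurePreserving_snd (μ := P) (ν := P)).map_eq, Measure.map_map hpath measurable_snd,
        measurePreserving_snd.map_eq]
      rfl⟩
  have hi : IndepFun (fun (p : Ω × Ω) v => X v p.1) (fun p v => X v p.2) (P.prod P) :=
    indepFun_prod hpath hpath
  exact ⟨hX.noCrossing _ _ _ _ hY hZ hYd hZd hi s t hst,
    hX.noCrossing _ _ _ _ hZ hY hZd hYd hi.symm s t hst⟩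

/-- A random variable hits every neighbourhood of a point of its support with positive
probability. -/
theorem measure_preimage_ne_zero_of_mem_rvSupport {Ω : Type*} [MeasurableSpace Ω] {P : Measure Ω}
    {U : Ω → ℝ} (hU : Measurable U) {x : ℝ} (hx : x ∈ rvSupport U P) {V : Set ℝ} (hV : IsOpen V)
    (hxV : x ∈ V) : P (U ⁻¹' V) ≠ 0 := by
  rw [← Measure.map_apply hU hV.measurableSet]
  exact ((Measure.mem_support_iff_forall _).1 hx V (hV.mem_nhds hxV)).ne'

theorem mainTheorem8 {Ω : Type u} [MeasurableSpace Ω] (P : Measure Ω) [IsProbabilityMeasure P]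
    (X : ℝ≥0 → Ω → ℝ) (hX : IsAlmostContinuous X P) :
    ∀ᵐ ω ∂P, Disjoint (jumpGap (fun t => X t ω)) (marginalSupport X P) := by
  -- Countability of `D` lets one null set of `ω` serve all pairs of times.
  obtain ⟨D, hDc, hD⟩ := TopologicalSpace.exists_countable_dense ℝ≥0
  have hcross : ∀ᵐ ω ∂P, ∀ s ∈ D, ∀ t ∈ D, s < t → ∀ᵐ ω' ∂P,
      ¬(X s ω < X s ω' ∧ X t ω' < X t ω ∧ ∀ v ∈ Ioo s t, X v ω ≠ X v ω') ∧
      ¬(X s ω' < X s ω ∧ X t ω < X t ω' ∧ ∀ v ∈ Ioo s t, X v ω' ≠ X v ω) := by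
    refine (ae_ball_iff hDc).2 fun s _ => (ae_ball_iff hDc).2 fun t _ => ?_
    by_cases hst : s < t
    · obtain ⟨h₁, h₂⟩ := hX.prod_noCrossing hst
      filter_upwards [Measure.ae_ae_of_ae_prod (measure_eq_zero_iff_ae_notMem.1 h₁),
        Measure.ae_ae_of_ae_prod (measure_eq_zero_iff_ae_notMem.1 h₂)] with ω hω₁ hω₂ _
      exact hω₁.and hω₂
    · exact .of_forall fun ω h => absurd h hst
  filter_upwards [hcross, hX.cadlag.cadlag] with ω hω hcω
  have hae : ∀ᵐ ω' ∂P, ∀ s ∈ D, ∀ t ∈ D, s < t →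
      ¬(X s ω < X s ω' ∧ X t ω' < X t ω ∧ ∀ v ∈ Ioo s t, X v ω ≠ X v ω') ∧
      ¬(X s ω' < X s ω ∧ X t ω < X t ω' ∧ ∀ v ∈ Ioo s t, X v ω' ≠ X v ω) :=
    (ae_ball_iff hDc).2 fun s hs => (ae_ball_iff hDc).2 fun t ht =>
      Filter.eventually_imp_distrib_left.2 (hω s hs t ht)
  rw [Set.disjoint_left]
  rintro ⟨T, x⟩ hgap hx
  -- `T` depends on `ω`, but `ω` is now frozen: for the copy `ω'`, `T` is a deterministic time, so
  -- fixed-time continuity applies.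
  have hgood := (hae.and hX.cadlag.cadlag).and
    (hX.continuousInProbability.ae_leftLim_eq hX.cadlag T)
  rcases hgap with hgap | hgap
  · refine measure_preimage_ne_zero_of_mem_rvSupport (hX.cadlag.measurable T) hx isOpen_Ioo hgap
      (measure_eq_zero_iff_ae_notMem.2 ?_)
    filter_upwards [hgood] with ω' ⟨⟨hn, hcω'⟩, hl⟩ hmem
    obtain ⟨s, hs, r, hr, hsr, h⟩ := hcω.exists_crossing hcω' hD (hl ▸ hmem.1) hmem.2
    exact (hn s hs r hr hsr).1 h
  · refine measure_preimage_ne_zero_of_mem_rvSupport (hX.cadlag.measurable T) hx isOpen_Ioo hgap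
      (measure_eq_zero_iff_ae_notMem.2 ?_)
    filter_upwards [hgood] with ω' ⟨⟨hn, hcω'⟩, hl⟩ hmem
    -- At a downward jump the copy is the path that passes from below to above.
    obtain ⟨s, hs, r, hr, hsr, h⟩ := hcω'.exists_crossing hcω hD (hl ▸ hmem.2) hmem.1
    exact (hn s hs r hr hsr).2 h
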